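/- Let $\mathfrak A$ be a $C^*$-algebra, let $H$ be a Hilbert $\mathfrak A$-module, and let $\mathcal L(H)$ be the $C^*$-algebra of adjointable operators on $H$, with the operator norm and unit $I$. An idempotent is a $Q\in\mathcal L(H)$ with $Q^2=Q$; a projection is a self-adjoint idempotent. A pair $(P,Q)$ is called a quasi-projection pair on $H$ if $P\in\mathcal L(H)$ is a projection and $Q\in\mathcal L(H)$ is an idempotent such that $$PQ^*P=PQP,\qquad PQ^*(I-P)=-PQ(I-P),\qquad (I-P)Q^*(I-P)=(I-P)Q(I-P).$$ The matched projection $m(Q)$ of an idempotent $Q\in\mathcal L(H)$ is defined as follows. If $Q$ is a projection, $m(Q)=Q$. Otherwise, let $P_{\mathcal R(Q)}$ be the projection of $H$ onto the range $\mathcal R(Q)$ of $Q$; its null space is $\mathcal N(Q^*)$, so $H=\mathcal R(Q)\oplus\mathcal N(Q^*)$ orthogonally, and with respect to this decomposition $$Q=\begin{pmatrix} I_1 & A\\ 0&0\end{pmatrix},\qquad A=(Q-P_{\mathcal R(Q)})|_{\mathcal N(Q^*)},$$ where $I_1$ is the identity of $\mathcal R(Q)$. With $B=(AA^*+I_1)^{1/2}$,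 put $$m(Q)=\frac12\begin{pmatrix}(B+I_1)B^{-1} & B^{-1}A\\ A^*B^{-1} & A^*[B(B+I_1)]^{-1}A\end{pmatrix}.$$ Theorem. If $(P,Q)$ is a quasi-projection pair on $H$ such that $\|P-Q\|<1$, then $P=m(Q)$ and $\|Q\|<\frac53$. -/

import Mathlib

namespace HilbertModule

section

variable (A H : Type*) [NonUnitalCStarAlgebra A] [PartialOrder A] [StarOrderedRing A]
  [NormedAddCommGroup H] [NormedSpace ℂ H] [SMul A H] [CStarModule A H]

/-- The algebra `𝓛(H)` of adjointable operators on the Hilbert `A`-module `H`: those `T` for which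
there is a map `S : H → H` with `⟪T x, y⟫ = ⟪x, S y⟫` for all `x`, `y`. Its norm, inherited from
`H →L[ℂ] H`, is the operator norm. Such a `T` is automatically `A`-linear. -/
def adjointable : Subalgebra ℂ (H →L[ℂ] H) where
  carrier := {T | ∃ S : H → H, ∀ x y : H, inner A (T x) y = inner A x (S y)}
  mul_mem' := by
    rintro T₁ T₂ ⟨S₁, h₁⟩ ⟨S₂, h₂⟩
    exact ⟨fun y => S₂ (S₁ y), fun x y => by simp [h₁, h₂]⟩
  add_mem' := by
    rintro T₁ T₂ ⟨S₁, h₁⟩ ⟨S₂, h₂⟩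
    exact ⟨fun y => S₁ y + S₂ y, fun x y => by simp [h₁, h₂]⟩
  algebraMap_mem' c := ⟨fun y => star c • y, fun x y => by
    simp [Algebra.algebraMap_eq_smul_one]⟩

variable {A H}

set_option linter.unusedSectionVars false in
theorem ext_inner {u v : H} (h : ∀ x : H, inner A x u = inner A x v) : u = v := by
  rw [← sub_eq_zero, ← CStarModule.inner_self (A := A), CStarModule.inner_sub_right, h, sub_self]

theorem exists_adjoint (T : adjointable A H) :
    ∃ S : adjointable A H, ∀ x y : H, inner A (T.1 x) y = inner A x (S.1 y) := by
  obtain ⟨S, hS⟩ := T.2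
  let L : H →ₗ[ℂ] H :=
    { toFun := S
      map_add' := fun y z => ext_inner (A := A) fun x => by
        rw [← hS, CStarModule.inner_add_right, CStarModule.inner_add_right, hS, hS]
      map_smul' := fun c y => ext_inner (A := A) fun x => by
        rw [← hS, RingHom.id_apply, CStarModule.inner_smul_right_complex,
          CStarModule.inner_smul_right_complex, hS] }
  have hb : ∀ y, ‖L y‖ ≤ ‖T.1‖ * ‖y‖ := by
    intro y
    rcases (norm_nonneg (L y)).eq_or_lt with h0 | h0
    · rw [← h0]; positivity
    · have h1 : ‖L y‖ ^ 2 ≤ ‖T.1‖ * ‖L y‖ * ‖y‖ := by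
        calc ‖L y‖ ^ 2 = ‖inner A (L y) (S y)‖ := CStarModule.norm_sq_eq A
          _ = ‖inner A (T.1 (L y)) y‖ := by rw [← hS]
          _ ≤ ‖T.1 (L y)‖ * ‖y‖ := CStarModule.norm_inner_le H
          _ ≤ ‖T.1‖ * ‖L y‖ * ‖y‖ := by gcongr; exact T.1.le_opNorm _
      nlinarith
  refine ⟨⟨L.mkContinuous _ hb, T.1, fun x y => ?_⟩, hS⟩
  rw [← CStarModule.star_inner y, ← CStarModule.star_inner (T.1 y) x, hS]
  rfl

/-- The adjoint `T*`. -/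
noncomputable instance : Star (adjointable A H) := ⟨fun T => (exists_adjoint T).choose⟩

theorem inner_left (T : adjointable A H) (x y : H) :
    inner A (T.1 x) y = inner A x ((star T).1 y) :=
  (exists_adjoint T).choose_spec x y

theorem inner_right (T : adjointable A H) (x y : H) :
    inner A ((star T).1 x) y = inner A x (T.1 y) := by
  rw [← CStarModule.star_inner y, ← CStarModule.star_inner (T.1 y) x, inner_left]

theorem star_eq_of_inner {T S : adjointable A H}
    (h : ∀ x y : H, inner A (T.1 x) y = inner A x (S.1 y)) : star T = S :=
  Subtype.ext (ContinuousLinearMap.ext fun y => ext_inner (A := A) fun x => by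
    rw [← h, inner_left])

noncomputable instance : StarRing (adjointable A H) where
  star_involutive T := star_eq_of_inner (inner_right T)
  star_mul T S := star_eq_of_inner fun x y => by simp [inner_left]
  star_add T S := star_eq_of_inner fun x y => by simp [inner_left]

instance : StarModule ℂ (adjointable A H) where
  star_smul c T := star_eq_of_inner fun x y => by simp [inner_left]

instance : CStarRing (adjointable A H) where
  norm_mul_self_le T := by
    have h : ‖T.1‖ ≤ √‖star T * T‖ := by
      refine ContinuousLinearMap.opNorm_le_bound _ (by positivity) fun x => ?_
      have h1 : ‖T.1 x‖ ^ 2 ≤ ‖star T * T‖ * ‖x‖ ^ 2 := by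
        calc ‖T.1 x‖ ^ 2 = ‖inner A (T.1 x) (T.1 x)‖ := CStarModule.norm_sq_eq A
          _ = ‖inner A x ((star T * T).1 x)‖ := by rw [inner_left]; rfl
          _ ≤ ‖x‖ * ‖(star T * T).1 x‖ := CStarModule.norm_inner_le H
          _ ≤ ‖x‖ * (‖star T * T‖ * ‖x‖) := by
            gcongr; exact (star T * T).1.le_opNorm _
          _ = ‖star T * T‖ * ‖x‖ ^ 2 := by ring
      refine le_of_sq_le_sq ?_ (by positivity)
      have h2 : √‖star T * T‖ ^ 2 = ‖star T * T‖ := Real.sq_sqrt (norm_nonneg (star T * T))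
      rwa [mul_pow, h2]
    calc ‖T‖ * ‖T‖ ≤ √‖star T * T‖ * √‖star T * T‖ := by gcongr <;> exact h
      _ = ‖star T * T‖ := Real.mul_self_sqrt (norm_nonneg _)

variable [CompleteSpace H]

theorem isClosed_adjointable : IsClosed (adjointable A H : Set (H →L[ℂ] H)) := by
  refine isClosed_of_closure_subset fun T hT => ?_
  obtain ⟨u, hu, hlim⟩ := mem_closure_iff_seq_limit.1 hT
  let v : ℕ → adjointable A H := fun n => ⟨u n, hu n⟩
  have hv : CauchySeq fun n => (star (v n)).1 := by
    have h := hlim.cauchySeq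
    rw [Metric.cauchySeq_iff] at h ⊢
    intro ε hε
    obtain ⟨N, hN⟩ := h ε hε
    refine ⟨N, fun m hm n hn => ?_⟩
    have := hN m hm n hn
    rw [dist_eq_norm] at this ⊢
    calc ‖(star (v m)).1 - (star (v n)).1‖ = ‖star (v m - v n)‖ := by rw [star_sub]; rfl
      _ = ‖u m - u n‖ := norm_star (v m - v n)
      _ < ε := this
  obtain ⟨S, hS⟩ := cauchySeq_tendsto_of_complete hv
  refine ⟨S, fun x y => ?_⟩
  have h1 : Filter.Tendsto (fun n => inner A (u n x) y) Filter.atTop (nhds (inner A (T x) y)) :=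
    (CStarModule.continuous_inner.tendsto (T x, y)).comp
      (((ContinuousLinearMap.apply ℂ H x).continuous.tendsto T).comp hlim |>.prodMk_nhds
        tendsto_const_nhds)
  have h2 : Filter.Tendsto (fun n => inner A x ((star (v n)).1 y)) Filter.atTop
      (nhds (inner A x (S y))) :=
    (CStarModule.continuous_inner.tendsto (x, S y)).comp
      (tendsto_const_nhds.prodMk_nhds
        (((ContinuousLinearMap.apply ℂ H y).continuous.tendsto S).comp hS))
  refine tendsto_nhds_unique h1 (h2.congr fun n => ?_)
  exact (inner_left (v n) x y).symm

instance : CompleteSpace (adjointable A H) :=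
  (isClosed_adjointable (A := A) (H := H)).completeSpace_coe

noncomputable instance : CStarAlgebra (adjointable A H) where

variable (A H) in
/-- The C⋆-algebra `𝓛(H)` as a type of its own, with the operations, involution and operator norm
of `adjointable A H`. -/
def Adjointable : Type _ := adjointable A H

instance : CoeFun (Adjointable A H) fun _ => H → H := ⟨fun T => T.1⟩

noncomputable instance : CStarAlgebra (Adjointable A H) :=
  inferInstanceAs (CStarAlgebra (adjointable A H))

/-- The order of the C⋆-algebra `𝓛(H)`: `S ≤ T` iff `T - S` is self-adjoint with non-negative
spectrum. -/
noncomputable instance : PartialOrder (Adjointable A H) := CStarAlgebra.spectralOrder _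

instance : StarOrderedRing (Adjointable A H) := CStarAlgebra.spectralOrderedRing _

namespace Adjointable

theorem mul_apply (S T : Adjointable A H) (x : H) : (S * T) x = S (T x) := rfl

theorem norm_def (T : Adjointable A H) : ‖T‖ = ‖(T.1 : H →L[ℂ] H)‖ := rfl

theorem inner_apply_left (T : Adjointable A H) (x y : H) :
    inner A (T x) y = inner A x ((star T) y) :=
  inner_left (A := A) (H := H) T x y

end Adjointable

end

section

variable {A H : Type*} [NonUnitalCStarAlgebra A] [PartialOrder A] [StarOrderedRing A]
  [NormedAddCommGroup H] [NormedSpace ℂ H] [SMul A H] [CStarModule A H] [CompleteSpace H]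

/-- `(P, Q)` is a quasi-projection pair on `H`: `P` is a projection and `Q` an idempotent in
`𝓛(H)`, subject to the three compression identities. -/
structure IsQuasiProjectionPair (P Q : Adjointable A H) : Prop where
  proj : IsStarProjection P
  idem : IsIdempotentElem Q
  corner₁₁ : P * star Q * P = P * Q * P
  corner₁₂ : P * star Q * (1 - P) = -(P * Q * (1 - P))
  corner₂₂ : (1 - P) * star Q * (1 - P) = (1 - P) * Q * (1 - P)

/-- The range of an idempotent in `𝓛(H)` is the range of a projection in `𝓛(H)`. -/
theorem exists_rangeProjection (Q : Adjointable A H) (hQ : IsIdempotentElem Q) :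
    ∃ p : Adjointable A H, IsStarProjection p ∧ Set.range p = Set.range Q := by
  have hs : star Q * star Q = star Q := by rw [← star_mul, hQ.eq]
  have hq : Q * Q = Q := hQ.eq
  set Z : Adjointable A H := Q + star Q - 1 with hZ
  have hZu : IsUnit Z := by
    rw [← isUnit_mul_self_iff]
    refine CStarAlgebra.isUnit_of_le 1 ?_
    have h : Z * Z = 1 + star (Q - star Q) * (Q - star Q) := by
      simp only [hZ, star_sub, star_star, mul_add, add_mul, mul_sub, sub_mul, mul_one, one_mul,
        hq, hs]
      abel
    rw [h]
    exact le_add_of_nonneg_right (star_mul_self_nonneg _)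
  have hZQ : Z * Q = star Q * Z := by
    simp only [hZ, mul_add, add_mul, mul_sub, sub_mul, mul_one, one_mul, hq, hs]
    abel
  have hZQ' : Z * Q = star Q * Q := by
    simp only [hZ, add_mul, sub_mul, one_mul, hq]
    abel
  have hZs : star Z = Z := by simp [hZ, add_comm]
  obtain ⟨u, hu⟩ := hZu
  obtain ⟨W, hWZ, hZW⟩ : ∃ W, W * Z = 1 ∧ Z * W = 1 :=
    ⟨(u⁻¹ : (Adjointable A H)ˣ), by simp [← hu], by simp [← hu]⟩
  have hWs : star W = W := by
    have h : star W * Z = 1 := by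
      have := congrArg star hZW
      rwa [star_mul, hZs, star_one] at this
    calc star W = star W * (Z * W) := by rw [hZW, mul_one]
      _ = W := by rw [← mul_assoc, h, one_mul]
  have hQW : Q * W = W * star Q := by
    calc Q * W = W * (Z * Q) * W := by rw [← mul_assoc, hWZ, one_mul]
      _ = W * star Q * (Z * W) := by rw [hZQ]; simp only [mul_assoc]
      _ = W * star Q := by rw [hZW, mul_one]
  have hpQ : Q * W * Q = Q := by
    rw [hQW, mul_assoc, ← hZQ', ← mul_assoc, hWZ, one_mul]
  have hQp : Q * (Q * W) = Q * W := by rw [← mul_assoc, hq]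
  refine ⟨Q * W, ⟨?_, ?_⟩, ?_⟩
  · show Q * W * (Q * W) = Q * W
    rw [← mul_assoc, hpQ]
  · show star (Q * W) = Q * W
    rw [star_mul, hWs, hQW]
  · ext y
    constructor
    · rintro ⟨x, rfl⟩
      exact ⟨(Q * W) x, by rw [← Adjointable.mul_apply, hQp]⟩
    · rintro ⟨x, rfl⟩
      exact ⟨Q x, by rw [← Adjointable.mul_apply, hpQ]⟩

/-- The projection `P_{𝓡(Q)}` of `H` onto the range of the idempotent `Q`. -/
noncomputable def rangeProjection (Q : Adjointable A H) (hQ : IsIdempotentElem Q) :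
    Adjointable A H :=
  (exists_rangeProjection Q hQ).choose

/-- The projection given, with respect to `H = 𝓡(Q) ⊕ 𝓝(Q*)`, by the block matrix
`½ [[(B + 1) B⁻¹, B⁻¹ a], [a* B⁻¹, a* (B (B + 1))⁻¹ a]]`, where `a` is the upper right corner of
`Q = [[1, a], [0, 0]]` and `B = (a a* + 1)^{1/2}`. Here `p` is the projection onto `𝓡(Q)`, so
`1 - p` is the one onto `𝓝(Q*)`; each block is written as an operator on `H` cut down by `p` and
`1 - p`, and `a` is extended by zero to `H`, so that `B` is extended by the identity of `𝓝(Q*)`. -/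
noncomputable def blockProjection (Q : Adjointable A H) (hQ : IsIdempotentElem Q) :
    Adjointable A H :=
  let p := rangeProjection Q hQ
  let a := (Q - p) * (1 - p)
  let B := CFC.sqrt (a * star a + 1)
  (1 / 2 : ℂ) •
    (p * ((B + 1) * Ring.inverse B) * p
      + p * (Ring.inverse B * a) * (1 - p)
      + (1 - p) * (star a * Ring.inverse B) * p
      + (1 - p) * (star a * Ring.inverse (B * (B + 1)) * a) * (1 - p))

open Classical in
/-- The matched projection `m(Q)` of an idempotent `Q`. -/
noncomputable def matchedProjection (Q : Adjointable A H) (hQ : IsIdempotentElem Q) :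
    Adjointable A H :=
  if IsStarProjection Q then Q else blockProjection Q hQ

end

end HilbertModule

/-! Put `S = 2P - 1` and `R = 2Q - 1`. The compression identities amount to `star Q = S Q S`, so `S
R` is self-adjoint. Since `1 - S R = S (S - R)` has norm `2‖P - Q‖ < 2`, the spectrum of `S R` lies
in `(-1, 3)`. Its inverse `R S` is conjugate to it by `S`, so the spectrum is stable under inversion
and hence lies in `(1/3, 3)`.

Therefore `C = (S R + R S) / 2`, the image of `S R` under `t ↦ (t + t⁻¹) / 2`, is positive with norm
below `5/3`, and `S C = Q + star Q - 1` (`polar_of_norm_sub_lt_two`). Thus `C` is the modulus of `Q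
+ star Q - 1` and `S` its sign, so `Q` alone determines `P = (1 + S) / 2`. In blocks, `Q + star Q -
1` is `[[1, a], [a⋆, -1]]`, and dividing by its modulus gives the matrix of `m(Q)` (`block_sum_eq`).
The norm bound follows from `‖Q‖ ≤ ‖Q + star Q - 1‖ = ‖C‖`. -/

section

variable {𝔅 : Type*}

/-! ### Symmetries and polar decomposition -/

/-- The compression identities of a quasi-projection pair say that `(2P - 1) Q` is self-adjoint. -/
theorem star_mul_symmetry_of_corners [Ring 𝔅] [StarRing 𝔅] {P Q : 𝔅} (hP : star P = P)
    (h₁₁ : P * star Q * P = P * Q * P)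
    (h₁₂ : P * star Q * (1 - P) = -(P * Q * (1 - P)))
    (h₂₂ : (1 - P) * star Q * (1 - P) = (1 - P) * Q * (1 - P)) :
    star Q * (P + P - 1) = (P + P - 1) * Q := by
  have h₂₁ := congrArg star h₁₂
  simp only [star_mul, star_sub, star_one, star_neg, star_star, hP] at h₂₁
  simp only [mul_sub, sub_mul, mul_one, one_mul, ← mul_assoc] at *
  -- The four blocks of `star Q` add up to `(2P - 1) Q (2P - 1)`, expanded here.
  have e : star Q = Q - 2 • (P * Q) - 2 • (Q * P) + 4 • (P * Q * P) := by
    linear_combination (norm := (noncomm_ring)) h₂₂ + h₁₂ + h₂₁ + h₁₁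
  have e' : star Q * P = 2 • (P * Q * P) - Q * P := by
    linear_combination (norm := (noncomm_ring)) h₁₁ + h₂₁
  simp only [mul_add, add_mul, e']
  rw [e]
  noncomm_ring

/-- If `S` is a self-adjoint involution and `R` an involution with `‖S - R‖ < 2`, then the real
spectrum of `S R`, being stable under inversion, lies in `(1/3, 3)`. -/
theorem spectrum_mul_subset_Ioo [CStarAlgebra 𝔅] {S R : 𝔅} (hS : star S = S) (hSS : S * S = 1)
    (hRR : R * R = 1) (hn : ‖S - R‖ < 2) :
    spectrum ℝ (S * R) ⊆ Set.Ioo (1 / 3) 3 := by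
  cases subsingleton_or_nontrivial 𝔅
  · simp
  have hSu : S ∈ unitary 𝔅 := by simp [Unitary.mem_iff, hS, hSS]
  have hbd : ∀ t ∈ spectrum ℝ (S * R), -1 < t ∧ t < 3 := by
    intro t ht
    -- `1 - S R = S (S - R)`, and the unitary `S` does not change the norm.
    have h1 : (1 : ℝ) - t ∈ spectrum ℝ (S * (S - R)) := by
      have h := spectrum.singleton_sub_eq (S * R) (1 : ℝ)
      rw [map_one, ← hSS, ← mul_sub] at h
      rw [← h]
      exact Set.sub_mem_sub rfl ht
    have h2 := spectrum.norm_le_norm_of_mem h1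
    rw [CStarRing.norm_mem_unitary_mul _ hSu, Real.norm_eq_abs] at h2
    have h3 := abs_lt.1 (h2.trans_lt hn)
    constructor <;> linarith [h3.1, h3.2]
  let s : 𝔅ˣ := ⟨S, S, hSS, hSS⟩
  let r : 𝔅ˣ := ⟨R, R, hRR, hRR⟩
  intro t ht
  have ht0 : t ≠ 0 := spectrum.ne_zero_of_mem_of_unit (a := s * r) ht
  -- `(S R)⁻¹ = R S` is conjugate to `S R` by `S`.
  have hinv : t⁻¹ ∈ spectrum ℝ (S * R) := by
    have h1 := (spectrum.inv_mem_iff (r := Units.mk0 t ht0) (a := s * r)).1 ht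
    have h2 : spectrum ℝ (S * (R * S) * S) = spectrum ℝ (R * S) :=
      spectrum.units_conjugate (a := R * S) (u := s)
    have h3 : S * (R * S) * S = S * R := by rw [← mul_assoc, mul_assoc, hSS, mul_one]
    rw [← h3, h2]
    simpa [s, r, mul_inv_rev] using h1
  obtain ⟨h1, h2⟩ := hbd t ht
  obtain ⟨h3, h4⟩ := hbd _ hinv
  -- A negative `t` and its inverse would both lie in `(-1, 0)`, yet their product is `1`.
  have hpos : 0 < t := by
    by_contra hneg
    have hlt : t < 0 := lt_of_le_of_ne (not_lt.1 hneg) ht0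
    have : t * t⁻¹ = 1 := mul_inv_cancel₀ ht0
    nlinarith
  refine ⟨?_, h2⟩
  have : t * t⁻¹ = 1 := mul_inv_cancel₀ ht0
  nlinarith

/-- A symmetry `S` making `S R` self-adjoint and at distance less than `2` from the involution `R`
is the unitary part of the self-adjoint element `(R + R⋆) / 2`, whose modulus is less than `5/3`. -/
theorem polar_of_norm_sub_lt_two [CStarAlgebra 𝔅] [PartialOrder 𝔅] [StarOrderedRing 𝔅]
    {S R : 𝔅} (hS : star S = S) (hSS : S * S = 1) (hRR : R * R = 1) (hSR : star R * S = S * R)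
    (hn : ‖S - R‖ < 2) :
    ∃ C : 𝔅, 0 ≤ C ∧ ‖C‖ < 5 / 3 ∧ (2 : ℝ) • (S * C) = R + star R ∧ C * S = S * C := by
  have hsp := spectrum_mul_subset_Ioo hS hSS hRR hn
  have hT : IsSelfAdjoint (S * R) := by rw [IsSelfAdjoint, star_mul, hS, hSR]
  let u : 𝔅ˣ := ⟨S * R, R * S, by rw [mul_assoc, ← mul_assoc R, hRR, one_mul, hSS],
    by rw [mul_assoc, ← mul_assoc S, hSS, one_mul, hRR]⟩
  have hne : ∀ t ∈ spectrum ℝ (S * R), t ≠ 0 := fun t ht => by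
    have := (hsp ht).1
    intro h
    norm_num [h] at this
  have hcont : ContinuousOn (fun t : ℝ => t⁻¹) (spectrum ℝ (S * R)) :=
    continuousOn_inv₀.mono hne
  have hC : cfc (fun t : ℝ => (1 / 2 : ℝ) * (t + t⁻¹)) (S * R)
      = (1 / 2 : ℝ) • (S * R + R * S) := by
    rw [cfc_const_mul (1 / 2 : ℝ) (fun t : ℝ => t + t⁻¹) (S * R)
      (continuousOn_id.add hcont), cfc_add (S * R) (fun t : ℝ => t) (fun t => t⁻¹)
      continuousOn_id hcont, cfc_id' ℝ (S * R)]
    congr 2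
    exact cfc_inv_id u hT
  have hSRS : S * R * S = star R := by rw [← hSR, mul_assoc, hSS, mul_one]
  refine ⟨(1 / 2 : ℝ) • (S * R + R * S), ?_, ?_, ?_, ?_⟩
  · rw [← hC]
    refine cfc_nonneg fun t ht => ?_
    have := (hsp ht).1
    positivity
  · rw [← hC]
    -- `(t + t⁻¹) / 2` equals `5/3` exactly at `t = 1/3` and `t = 3`; compactness of the spectrum
    -- keeps the bound strict for the norm.
    refine norm_cfc_lt (by norm_num) fun t ht => ?_
    obtain ⟨h1, h2⟩ := hsp ht
    have h0 : 0 < t := by linarith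
    rw [Real.norm_of_nonneg (by positivity)]
    have h3 : t * t⁻¹ = 1 := mul_inv_cancel₀ h0.ne'
    have h4 : 0 < t⁻¹ := inv_pos.2 h0
    have h5 : t⁻¹ < 3 := by nlinarith
    nlinarith
  · rw [mul_smul_comm, smul_smul, mul_add, ← mul_assoc, ← mul_assoc, hSS, hSRS]
    norm_num
  · rw [mul_smul_comm, smul_mul_assoc, mul_add, add_mul, mul_assoc R, hSS, hSRS, ← mul_assoc,
      ← mul_assoc, hSS, hSRS, mul_one, one_mul, add_comm]

/-! ### The block matrix -/

/-- A nonnegative element commutes with everything that commutes with its square. -/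
theorem commute_of_commute_mul_self [CStarAlgebra 𝔅] [PartialOrder 𝔅] [StarOrderedRing 𝔅]
    {C x : 𝔅} (hC : 0 ≤ C) (h : Commute (C * C) x) : Commute C x := by
  have := h.cfcₙ_nnreal NNReal.sqrt
  rwa [← CFC.sqrt, CFC.sqrt_mul_self C] at this

/-- The entries of the block matrix of `blockProjection` add up to `1 + (2p - 1 + a + a⋆) C⁻¹`,
where `C = (1 + a a⋆ + a⋆ a)^{1/2}`. -/
theorem block_sum_eq [CStarAlgebra 𝔅] [PartialOrder 𝔅] [StarOrderedRing 𝔅] {p a C S : 𝔅}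
    (hp : IsStarProjection p) (hpa : p * a = a) (hap : a * p = 0) (hC : 0 ≤ C)
    (hCC : C * C = (p + p - 1 + a + star a) * (p + p - 1 + a + star a))
    (hSC : S * C = p + p - 1 + a + star a) :
    p * ((CFC.sqrt (a * star a + 1) + 1) * Ring.inverse (CFC.sqrt (a * star a + 1))) * p
      + p * (Ring.inverse (CFC.sqrt (a * star a + 1)) * a) * (1 - p)
      + (1 - p) * (star a * Ring.inverse (CFC.sqrt (a * star a + 1))) * p
      + (1 - p) * (star a * Ring.inverse
          (CFC.sqrt (a * star a + 1) * (CFC.sqrt (a * star a + 1) + 1)) * a) * (1 - p)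
      = 1 + S := by
  have hpp : p * p = p := hp.isIdempotentElem
  have hps : star p = p := hp.isSelfAdjoint
  have hap' : star a * p = star a := by simpa [hps] using congrArg star hpa
  have hpa' : p * star a = 0 := by simpa [hps] using congrArg star hap
  have haa : a * a = 0 := by
    calc a * a = a * p * a := by rw [mul_assoc, hpa]
      _ = 0 := by rw [hap, zero_mul]
  have haa' : star a * star a = 0 := by rw [← star_mul, haa, star_zero]
  -- The off-diagonal blocks cancel in the square of `[[1, a], [a⋆, -1]]`, so `C` will commute with
  -- `p`.
  replace hCC : C * C = 1 + a * star a + star a * a := by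
    rw [hCC]
    simp only [mul_add, add_mul, mul_sub, sub_mul, mul_one, one_mul, hpp, hpa, hap, hpa', hap',
      haa, haa']
    abel
  have hCu : IsUnit C := by
    rw [← isUnit_mul_self_iff, hCC, add_assoc]
    exact CStarAlgebra.isUnit_of_le 1 (le_add_of_nonneg_right
      (add_nonneg (mul_star_self_nonneg a) (star_mul_self_nonneg a)))
  have cp : C * p = p * C := commute_of_commute_mul_self hC <| by
    rw [hCC, commute_iff_eq]
    simp only [mul_add, add_mul, one_mul, mul_one, mul_assoc, hap, hap', mul_zero]
    simp only [← mul_assoc, hpa, hpa', zero_mul]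
  -- Both `C² a` and `a C²` equal `a + a a⋆ a`, because `a² = 0`.
  have ca : C * a = a * C := commute_of_commute_mul_self hC <| by
    rw [hCC, commute_iff_eq]
    simp only [mul_add, add_mul, one_mul, mul_one, mul_assoc, haa, mul_zero]
    simp only [← mul_assoc, haa, zero_mul, add_zero]
  obtain ⟨D, hDC, hCD⟩ : ∃ D, D * C = 1 ∧ C * D = 1 :=
    ⟨Ring.inverse C, Ring.inverse_mul_cancel _ hCu, Ring.mul_inverse_cancel _ hCu⟩
  obtain ⟨E, hEC, hCE⟩ : ∃ E, E * (C + 1) = 1 ∧ (C + 1) * E = 1 := by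
    have hu : IsUnit (C + 1) := CStarAlgebra.isUnit_of_le 1 (le_add_of_nonneg_left hC)
    exact ⟨_, Ring.inverse_mul_cancel _ hu, Ring.mul_inverse_cancel _ hu⟩
  have ea : E * a = a * E := by
    rw [← mul_one (E * a), ← hCE, ← mul_assoc, mul_assoc E, mul_add, mul_one, ← ca,
      show C * a + a = (C + 1) * a by rw [add_mul, one_mul], ← mul_assoc, hEC, one_mul]
  have comm_D : ∀ x, C * x = x * C → D * x = x * D := fun x hx => by
    rw [← mul_one (D * x), ← hCD, ← mul_assoc, mul_assoc D, ← hx, ← mul_assoc, hDC, one_mul]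
  have dp := comm_D p cp
  have da := comm_D a ca
  -- `B` is the `p`-corner of `C` completed by the identity, since `p C² = p + a a⋆`.
  have hB : CFC.sqrt (a * star a + 1) = p * C + (1 - p) := by
    refine CFC.sqrt_unique ?_ ?_
    · have hpCC : p * (C * C) = p + a * star a := by
        rw [hCC, mul_add, mul_add, ← mul_assoc, ← mul_assoc, hpa, hpa', zero_mul, add_zero,
          mul_one]
      have h1 : p * C * (p * C) = p * (C * C) := by
        rw [mul_assoc, ← mul_assoc C, cp, mul_assoc, ← mul_assoc, hpp]
      have h2 : p * C * p = p * C := by rw [mul_assoc, cp, ← mul_assoc, hpp]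
      have h3 : p * (p * C) = p * C := by rw [← mul_assoc, hpp]
      simp only [mul_add, add_mul, mul_sub, sub_mul, mul_one, one_mul, h1, h2, h3, hpp, hpCC]
      abel
    · have h1 : p * C = p * C * star p := by rw [hps, mul_assoc, cp, ← mul_assoc, hpp]
      rw [h1]
      exact add_nonneg (star_right_conjugate_nonneg hC p) hp.one_sub.nonneg
  rw [hB]
  set B := p * C + (1 - p) with hBdef
  have hBC : p * B = p * C := by
    rw [hBdef, mul_add, mul_sub, ← mul_assoc, hpp, mul_one, sub_self, add_zero]
  have cpB : B * p = p * B := by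
    rw [hBC, hBdef, add_mul, sub_mul, mul_assoc, cp, ← mul_assoc, hpp, one_mul, sub_self,
      add_zero]
  have hB0 : 0 ≤ B := hB ▸ CFC.sqrt_nonneg _
  have hB1 : IsUnit (B + 1) := CStarAlgebra.isUnit_of_le 1 (le_add_of_nonneg_left hB0)
  -- Cutting to the `p`-corner and completing by `1 - p` respects inverses, so `B⁻¹` is obtained
  -- from `D = C⁻¹` in the same way.
  have corner_mul : ∀ x y, x * p = p * x → x * y = 1 →
      (p * x + (1 - p)) * (p * y + (1 - p)) = 1 := fun x y hx hxy => by
    have h1 : p * x * p = p * x := by rw [mul_assoc, hx, ← mul_assoc, hpp]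
    have h2 : p * x * (p * y) = p := by rw [← mul_assoc, h1, mul_assoc, hxy, mul_one]
    have h3 : p * (p * y) = p * y := by rw [← mul_assoc, hpp]
    simp only [mul_add, add_mul, mul_sub, sub_mul, mul_one, one_mul, h1, h2, h3, hpp]
    abel
  obtain ⟨W, hW⟩ : ∃ W, W = p * D + (1 - p) := ⟨_, rfl⟩
  have hWB : W * B = 1 := hW ▸ corner_mul D C dp hDC
  have hBW : B * W = 1 := hW ▸ corner_mul C D cp hCD
  have hBu : IsUnit B := ⟨⟨B, W, hBW, hWB⟩, rfl⟩
  have hBi : Ring.inverse B = W :=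
    left_inv_eq_right_inv (Ring.inverse_mul_cancel _ hBu) hBW
  -- On the range of `p`, `B` acts as `C`, which commutes with `a`; so the inverse passes through
  -- `a` as `(C + 1)⁻¹ C⁻¹`.
  have hF : Ring.inverse (B * (B + 1)) * a = a * (E * D) := by
    have hM : B * (B + 1) * (p * (E * D)) = p := by
      calc B * (B + 1) * (p * (E * D)) = B * ((B * p + p) * (E * D)) := by noncomm_ring
        _ = B * ((p * C + p) * (E * D)) := by rw [cpB, hBC]
        _ = B * p * ((C + 1) * E * D) := by noncomm_ring
        _ = p := by rw [hCE, one_mul, cpB, hBC, mul_assoc, hCD, mul_one]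
    calc Ring.inverse (B * (B + 1)) * a
        = Ring.inverse (B * (B + 1)) * (B * (B + 1) * (p * (E * D))) * a := by
          rw [hM, mul_assoc, hpa]
      _ = p * (E * D) * a := by rw [Ring.inverse_mul_cancel_left _ _ (hBu.mul hB1)]
      _ = p * a * (E * D) := by
        rw [mul_assoc, mul_assoc, da, ← mul_assoc E, ea, mul_assoc, ← mul_assoc]
      _ = a * (E * D) := by rw [hpa]
  -- `a⋆ a = (1 - p)(C² - 1)`, and `C² - 1 = (C - 1)(C + 1)` cancels the factor `C + 1`.
  have key : star a * a * (E * D) = (1 - p) * (1 - D) := by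
    have h1 : star a * a = (1 - p) * ((C - 1) * (C + 1)) := by
      have h2 : (C - 1) * (C + 1) = a * star a + star a * a := by
        rw [← sub_eq_zero, ← sub_eq_zero.2 hCC]
        noncomm_ring
      rw [h2, sub_mul, one_mul, mul_add, ← mul_assoc, ← mul_assoc, hpa, hpa', zero_mul]
      abel
    rw [h1, mul_assoc, mul_assoc, ← mul_assoc _ E, hCE, one_mul, sub_mul C, hCD, one_mul]
  have hWa : W * a = a * D := by
    rw [hW, add_mul, sub_mul, one_mul, hpa, sub_self, add_zero, mul_assoc, da, ← mul_assoc, hpa]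
  have haW : star a * W = star a * D := by
    rw [hW, mul_add, mul_sub, mul_one, ← mul_assoc, hap', sub_self, add_zero]
  have h₁₁ : p * ((B + 1) * W) * p = p + p * D := by
    rw [add_mul, hBW, one_mul, hW]
    have h1 : p * D * p = p * D := by rw [mul_assoc, dp, ← mul_assoc, hpp]
    have h2 : p * (p * D) = p * D := by rw [← mul_assoc, hpp]
    simp only [mul_add, add_mul, mul_sub, sub_mul, mul_one, h1, h2, hpp]
    abel
  have h₁₂ : p * (W * a) * (1 - p) = a * D := by
    rw [hWa, ← mul_assoc, hpa, mul_sub, mul_one, mul_assoc, dp, ← mul_assoc, hap, zero_mul,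
      sub_zero]
  have h₂₁ : (1 - p) * (star a * W) * p = star a * D := by
    rw [haW, sub_mul, one_mul, ← mul_assoc, hpa', zero_mul, sub_zero, mul_assoc, dp, ← mul_assoc,
      hap']
  have h₂₂ : (1 - p) * (star a * Ring.inverse (B * (B + 1)) * a) * (1 - p)
      = (1 - p) * (1 - D) := by
    rw [mul_assoc (star a), hF, ← mul_assoc (star a), key]
    have h1 : p * D * p = p * D := by rw [mul_assoc, dp, ← mul_assoc, hpp]
    have h2 : p * (p * D) = p * D := by rw [← mul_assoc, hpp]
    simp only [mul_sub, sub_mul, mul_one, one_mul, h1, h2, hpp, dp]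
    abel
  have hS : S = (p + p - 1 + a + star a) * D := by rw [← hSC, mul_assoc, hCD, mul_one]
  rw [hBi, h₁₁, h₁₂, h₂₁, h₂₂, hS]
  noncomm_ring

end

/-! ### Norm of an idempotent -/

/-- The norm of an idempotent `Q` is at most that of `Q + Q⋆ - 1`. -/
theorem norm_le_norm_add_star_sub_one {𝔅 : Type*} [CStarAlgebra 𝔅] {Q : 𝔅}
    (hQ : IsIdempotentElem Q) : ‖Q‖ ≤ ‖Q + star Q - 1‖ := by
  rcases (norm_nonneg Q).eq_or_lt with h0 | h0
  · rw [← h0]; exact norm_nonneg _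
  · have h1 : star Q * Q = (Q + star Q - 1) * Q := by
      rw [sub_mul, add_mul, hQ.eq, one_mul, add_sub_cancel_left]
    have h2 : ‖Q‖ * ‖Q‖ ≤ ‖Q + star Q - 1‖ * ‖Q‖ := by
      rw [← CStarRing.norm_star_mul_self, h1]
      exact norm_mul_le _ _
    exact le_of_mul_le_mul_right h2 h0

/-! ### Application to operators on the module -/

namespace HilbertModule

variable {A H : Type*} [NonUnitalCStarAlgebra A] [PartialOrder A] [StarOrderedRing A]
  [NormedAddCommGroup H] [NormedSpace ℂ H] [SMul A H] [CStarModule A H] [CompleteSpace H]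

theorem Adjointable.mul_eq_of_range_subset {p Q : Adjointable A H} (hp : IsIdempotentElem p)
    (h : Set.range Q ⊆ Set.range p) : p * Q = Q :=
  Subtype.ext <| ContinuousLinearMap.ext fun x => by
    obtain ⟨y, hy⟩ := h ⟨x, rfl⟩
    rw [Adjointable.mul_apply, ← hy, ← Adjointable.mul_apply, hp.eq]

theorem isStarProjection_rangeProjection (Q : Adjointable A H) (hQ : IsIdempotentElem Q) :
    IsStarProjection (rangeProjection Q hQ) :=
  (exists_rangeProjection Q hQ).choose_spec.1

theorem range_rangeProjection (Q : Adjointable A H) (hQ : IsIdempotentElem Q) :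
    Set.range (rangeProjection Q hQ) = Set.range Q :=
  (exists_rangeProjection Q hQ).choose_spec.2

end HilbertModule

open HilbertModule in
theorem mainTheorem10 {A H : Type*} [NonUnitalCStarAlgebra A] [PartialOrder A] [StarOrderedRing A]
    [NormedAddCommGroup H] [NormedSpace ℂ H] [SMul A H] [CStarModule A H] [CompleteSpace H]
    (P Q : HilbertModule.Adjointable A H) (h : HilbertModule.IsQuasiProjectionPair P Q)
    (hPQ : ‖P - Q‖ < 1) :
    P = HilbertModule.matchedProjection Q h.idem ∧ ‖Q‖ < 5 / 3 := by
  have hP : star P = P := h.proj.isSelfAdjoint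
  have hPP : P * P = P := h.proj.isIdempotentElem
  have hQQ : Q * Q = Q := h.idem
  obtain ⟨S, hSdef⟩ : ∃ S, S = P + P - 1 := ⟨_, rfl⟩
  have hS : star S = S := by simp [hSdef, hP]
  have hSS : S * S = 1 := by
    simp only [hSdef, mul_add, add_mul, mul_sub, sub_mul, mul_one, one_mul, hPP]
    abel
  have hSQ : star Q * S = S * Q :=
    hSdef ▸ star_mul_symmetry_of_corners hP h.corner₁₁ h.corner₁₂ h.corner₂₂
  obtain ⟨C, hC, hCn, hSC, hCS⟩ := polar_of_norm_sub_lt_two (S := S) (R := Q + Q - 1) hS hSS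
    (by
      simp only [mul_add, add_mul, mul_sub, sub_mul, mul_one, one_mul, hQQ]
      abel)
    (by simp only [star_sub, star_add, star_one, sub_mul, add_mul, mul_add, mul_sub, hSQ, mul_one,
      one_mul])
    (by
      have h1 : S - (Q + Q - 1) = (2 : ℝ) • (P - Q) := by rw [hSdef, two_smul]; abel
      rw [h1, norm_smul]
      norm_num
      linarith)
  replace hSC : S * C = Q + star Q - 1 := by
    have h2 : (2 : ℝ) • (S * C) = (2 : ℝ) • (Q + star Q - 1) := by
      rw [hSC, two_smul]
      simp only [star_sub, star_add, star_one]
      abel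
    exact smul_right_injective _ two_ne_zero h2
  have hCSC : C = S * (Q + star Q - 1) := by rw [← hSC, ← mul_assoc, hSS, one_mul]
  -- `C` is the positive square root of `(Q + star Q - 1)²`.
  have hCC : C * C = (Q + star Q - 1) * (Q + star Q - 1) := by
    rw [← hSC, mul_assoc, ← mul_assoc C, hCS, mul_assoc, ← mul_assoc, hSS, one_mul]
  constructor
  · have hP2 : P = (1 / 2 : ℂ) • (1 + S) := by
      rw [hSdef, add_sub_cancel, ← two_smul ℂ P, smul_smul]
      norm_num
    rw [matchedProjection]
    split_ifs with hQp
    · have hC1 : C = 1 := by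
        have h1 : C * C = 1 * 1 := by
          rw [hCC, hQp.isSelfAdjoint.star_eq]
          simp only [mul_add, add_mul, mul_sub, sub_mul, mul_one, one_mul, hQQ]
          abel
        rw [← CFC.sqrt_mul_self C, h1, CFC.sqrt_mul_self (1 : Adjointable A H) zero_le_one]
      rw [hC1, mul_one, hQp.isSelfAdjoint.star_eq] at hSC
      rw [hP2, hSC, add_sub_cancel, ← two_smul ℂ Q, smul_smul]
      norm_num
    · refine hP2.trans ?_
      rw [blockProjection]
      have hp := isStarProjection_rangeProjection Q h.idem
      -- Two idempotents with the same range act as the identity on each other's values; this gives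
      -- `Q` the form `[[1, a], [0, 0]]` with `a = Q - p`.
      have hpQ : rangeProjection Q h.idem * Q = Q :=
        Adjointable.mul_eq_of_range_subset hp.isIdempotentElem (range_rangeProjection Q h.idem).ge
      have hQp' : Q * rangeProjection Q h.idem = rangeProjection Q h.idem :=
        Adjointable.mul_eq_of_range_subset h.idem (range_rangeProjection Q h.idem).le
      generalize rangeProjection Q h.idem = p at *
      have hpp : p * p = p := hp.isIdempotentElem
      have hps : star p = p := hp.isSelfAdjoint
      have ha : (Q - p) * (1 - p) = Q - p := by
        rw [mul_sub, mul_one, sub_mul, hQp', hpp, sub_self, sub_zero]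
      have hpa : p * (Q - p) = Q - p := by rw [mul_sub, hpQ, hpp]
      have hap : (Q - p) * p = 0 := by rw [sub_mul, hQp', hpp, sub_self]
      have hZ : Q + star Q - 1 = p + p - 1 + (Q - p) + star (Q - p) := by
        rw [star_sub, hps]
        abel
      rw [ha]
      refine congrArg _ (block_sum_eq hp hpa hap hC ?_ (hSC.trans hZ)).symm
      rw [hCC, hZ]
  · refine (norm_le_norm_add_star_sub_one h.idem).trans_lt ?_
    have hSu : S ∈ unitary (Adjointable A H) := by simp [Unitary.mem_iff, hS, hSS]
    rwa [← CStarRing.norm_mem_unitary_mul _ hSu, ← hCSC]
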